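/- Let $q$ and $a$ be complex numbers with $|q|<1$ and $a^2q^{2n}\neq 1$ for every integer $n\ge 0$. Then the series $\sum_{n\ge 0} \frac{q^n}{1-a^2q^{2n}}$ converges absolutely, and its sum is the value of a convergent infinite continued fraction: $$\sum_{n=0}^{\infty}\frac{q^n}{1-a^2q^{2n}}=\cfrac{1}{1-q+\cfrac{-a^2(1-q)^2}{1-q^3+\cfrac{-q\,a^2(1-q^2)^2}{1-q^5+\cfrac{-q^2a^2(1-q^3)^2}{1-q^7+\cdots}}}}$$ Here the first partial numerator is $1$, the $(n+2)$-nd is $-q^n a^2(1-q^{n+1})^2$ for $n\ge 0$, and the $(n+1)$-st partial denominator is $1-q^{2n+1}$ for $n\ge 0$. Convergence means that all but finitely many convergents $A_n/B_n$ have $B_n\ne 0$ and that they tend to the stated sum. -/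

import Mathlib

/-- The continued fraction `a₀/(b₀ + a₁/(b₁ + a₂/(b₂ + ⋯)))` with head term `0`, partial numerators
`num 0, num 1, …` and partial denominators `den 0, den 1, …`. -/
def infiniteContFract (num den : ℕ → ℂ) : GenContFract ℂ :=
  ⟨0, Stream'.Seq.ofStream (fun n : ℕ => (⟨num n, den n⟩ : GenContFract.Pair ℂ))⟩

/-- A continued fraction converges to the finite value `z`: its convergents `Aₙ / Bₙ` are defined
(that is, `Bₙ ≠ 0`) for all but finitely many `n`, and they tend to `z`. -/
def ContFractConvergesTo (g : GenContFract ℂ) (z : ℂ) : Prop :=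
  (∀ᶠ n in Filter.atTop, g.dens n ≠ 0) ∧ Filter.Tendsto g.convs Filter.atTop (nhds z)

/-- The partial numerators `1, -a²(1-q)², -q a²(1-q²)², -q² a²(1-q³)², …`. -/
def ramanujanNum (a q : ℂ) : ℕ → ℂ
  | 0 => 1
  | n + 1 => -(q ^ n * a ^ 2 * (1 - q ^ (n + 1)) ^ 2)

/-- The partial denominators `1 - q, 1 - q³, 1 - q⁵, …`. -/
def ramanujanDen (q : ℂ) (n : ℕ) : ℂ := 1 - q ^ (2 * n + 1)

/-!
With `p = q²`, `x = a²`, and the Heine-type series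
`S z n = ∑ₘ zᵐ (p^{m+1}; p)ₙ / (x pᵐ; p)ₙ₊₁`, the sum to be expanded is `S q 0`. Two two-term
relations between the summands give
`S z n - S (pz) n = z (S z (n+1) - x S (pz) (n+1))` and
`S z (n+1) - x p^{n+1} S (pz) (n+1) = S z n - p^{n+1} S (pz) n`,
and eliminating one series from both gives two contiguous relations. Used alternately, these show
that `S q 0`, `S (q³) 0`, `S (q³) 1`, `S (q⁵) 1`, … satisfy, up to elementary factors, the
recurrence of the continued fraction. The Casoratian with the denominators `Bₙ` is `(q; q)ₙ`; as the
series tend to `(p; p)_∞ / (x; p)_∞ ≠ 0`, this forces `Bₙ` to a nonzero limit, while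
`Aₙ - S q 0 * Bₙ` tends to `0`.
-/

open Filter Topology Finset

section Sequences

theorem exists_norm_div_le_of_tendsto {K : Type*} [NormedField K] {u : ℕ → K} {L : K}
    (hu : Tendsto u atTop (𝓝 L)) (hL : L ≠ 0) : ∃ C, ∀ m n, ‖u m / u n‖ ≤ C := by
  obtain ⟨C, hC⟩ := (Metric.isBounded_range_of_tendsto _ hu).exists_norm_le
  obtain ⟨D, hD⟩ := (Metric.isBounded_range_of_tendsto _ (hu.inv₀ hL)).exists_norm_le
  refine ⟨C * D, fun m n => ?_⟩
  rw [div_eq_mul_inv]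
  exact norm_mul_le_of_le (hC _ ⟨m, rfl⟩) (hD _ ⟨n, rfl⟩)

variable {R : Type*} [SeminormedRing R] {u α ε : ℕ → R} {L : R}

theorem isBoundedUnder_norm_of_affine_recurrence (h : ∀ᶠ n in atTop, u (n + 1) = α n + ε n * u n)
    (hα : Tendsto α atTop (𝓝 L)) (hε : Tendsto ε atTop (𝓝 0)) :
    IsBoundedUnder (· ≤ ·) atTop (‖u ·‖) := by
  obtain ⟨C, hC⟩ := hα.norm.isBoundedUnder_le
  have hε_half : ∀ᶠ n in atTop, ‖ε n‖ ≤ 1 / 2 :=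
    (tendsto_zero_iff_norm_tendsto_zero.1 hε).eventually_le_const (by norm_num)
  obtain ⟨N, hN⟩ := eventually_atTop.1 (h.and ((eventually_map.1 hC).and hε_half))
  refine ⟨max (2 * C) ‖u N‖, eventually_map.2 (eventually_atTop.2 ⟨N, fun n hn => ?_⟩)⟩
  induction n, hn using Nat.le_induction with
  | base => exact le_max_right _ _
  | succ n hn ih =>
    obtain ⟨hrec, hαn, hεn⟩ := hN n hn
    calc ‖u (n + 1)‖ ≤ ‖α n‖ + ‖ε n‖ * ‖u n‖ := by
          rw [hrec]
          exact norm_add_le_of_le le_rfl (norm_mul_le _ _)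
      _ ≤ C + 1 / 2 * max (2 * C) ‖u N‖ := by gcongr
      _ ≤ max (2 * C) ‖u N‖ := by linarith [le_max_left (2 * C) ‖u N‖]

theorem tendsto_of_affine_recurrence (h : ∀ᶠ n in atTop, u (n + 1) = α n + ε n * u n)
    (hα : Tendsto α atTop (𝓝 L)) (hε : Tendsto ε atTop (𝓝 0)) : Tendsto u atTop (𝓝 L) := by
  have hu := isBoundedUnder_norm_of_affine_recurrence h hα hε
  have hlim : Tendsto (fun n => α n + ε n * u n) atTop (𝓝 L) := by
    simpa only [add_zero] using hα.add (hε.zero_mul_isBoundedUnder_le hu)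
  exact (tendsto_add_atTop_iff_nat 1).1 (hlim.congr' (h.mono fun _ hn => hn.symm))

end Sequences

section ContinuedFraction

variable {K : Type*} [Field K] {g : GenContFract K} {b d r T : ℕ → K}

/-- `T` is a renormalized sequence of remainders of the continued fraction
`h + 1/(b₀ - d₀r₀/(b₁ - d₁r₁/(b₂ - ⋯)))`: the products `(∏ i < n, r i) * T n` solve the three-term
recurrence of its numerators and denominators, and its expected value is `h + T 0`. -/
structure IsRemainderSeq (g : GenContFract K) (b d r T : ℕ → K) : Prop where
  get?_zero : g.s.get? 0 = some ⟨1, b 0⟩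
  get?_succ (n : ℕ) : g.s.get? (n + 1) = some ⟨-(d n * r n), b (n + 1)⟩
  initial : b 0 * T 0 - r 0 * T 1 = 1
  recurrence (n : ℕ) : r (n + 1) * T (n + 2) = b (n + 1) * T (n + 1) - d n * T n

namespace IsRemainderSeq

theorem nums_eq (h : IsRemainderSeq g b d r T) (n : ℕ) :
    g.nums n = (g.h + T 0) * g.dens n - (∏ i ∈ range n, r i) * T n := by
  induction n using Nat.twoStepInduction with
  | zero =>
    rw [GenContFract.zeroth_num_eq_h, GenContFract.zeroth_den_eq_one, prod_range_zero]
    ring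
  | one =>
    rw [GenContFract.first_num_eq h.get?_zero, GenContFract.first_den_eq h.get?_zero,
      prod_range_one]
    linear_combination -h.initial
  | more n ih₀ ih₁ =>
    rw [GenContFract.nums_recurrence (h.get?_succ n) ih₀ ih₁,
      GenContFract.dens_recurrence (h.get?_succ n) rfl rfl]
    simp only [prod_range_succ]
    linear_combination (∏ i ∈ range n, r i) * r n * h.recurrence n

theorem casoratian_eq (h : IsRemainderSeq g b d r T) (n : ℕ) :
    T n * g.dens (n + 1) - r n * T (n + 1) * g.dens n = ∏ i ∈ range n, d i := by
  induction n with
  | zero =>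
    rw [GenContFract.first_den_eq h.get?_zero, GenContFract.zeroth_den_eq_one, prod_range_zero]
    linear_combination h.initial
  | succ n ih =>
    rw [GenContFract.dens_recurrence (h.get?_succ n) rfl rfl, prod_range_succ, ← ih]
    linear_combination -g.dens (n + 1) * h.recurrence n

end IsRemainderSeq

end ContinuedFraction

section ContinuedFractionLimit

variable {K : Type*} [NormedField K] {g : GenContFract K} {b d r T : ℕ → K} {D τ : K}

namespace IsRemainderSeq

theorem tendsto_dens (h : IsRemainderSeq g b d r T)
    (hd : Tendsto (fun n => ∏ i ∈ range n, d i) atTop (𝓝 D)) (hr : Tendsto r atTop (𝓝 0))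
    (hT : Tendsto T atTop (𝓝 τ)) (hτ : τ ≠ 0) : Tendsto g.dens atTop (𝓝 (D / τ)) := by
  have hε : Tendsto (fun n => r n * T (n + 1) / T n) atTop (𝓝 0) := by
    have := (hr.mul ((tendsto_add_atTop_iff_nat 1).2 hT)).div hT hτ
    rwa [zero_mul, zero_div] at this
  refine tendsto_of_affine_recurrence ?_ (hd.div hT hτ) hε
  filter_upwards [hT.eventually_ne hτ] with n hn
  rw [Pi.div_apply, ← h.casoratian_eq n]
  field_simp
  ring

theorem tendsto_convs (h : IsRemainderSeq g b d r T)
    (hd : Tendsto (fun n => ∏ i ∈ range n, d i) atTop (𝓝 D)) (hD : D ≠ 0)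
    (hr : Tendsto r atTop (𝓝 0)) (hT : Tendsto T atTop (𝓝 τ)) (hτ : τ ≠ 0) :
    (∀ᶠ n in atTop, g.dens n ≠ 0) ∧ Tendsto g.convs atTop (𝓝 (g.h + T 0)) := by
  have hdens := h.tendsto_dens hd hr hT hτ
  have hne := hdens.eventually_ne (div_ne_zero hD hτ)
  have hprod : Tendsto (fun n => ∏ i ∈ range n, r i) atTop (𝓝 0) :=
    tendsto_of_affine_recurrence (α := fun _ => 0)
      (.of_forall fun n => by rw [prod_range_succ, zero_add, mul_comm]) tendsto_const_nhds hr
  have herr := ((hprod.mul hT).div hdens (div_ne_zero hD hτ)).const_sub (g.h + T 0)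
  rw [zero_mul, zero_div, sub_zero] at herr
  refine ⟨hne, herr.congr' (hne.mono fun n hn => ?_)⟩
  rw [GenContFract.conv_eq_num_div_den, h.nums_eq, sub_div, mul_div_cancel_right₀ _ hn]
  rfl

end IsRemainderSeq

end ContinuedFractionLimit

section QPochhammer

variable {R : Type*} [CommRing R]

/-- The finite `q`-Pochhammer symbol `(x; p)ₙ = ∏_{i < n} (1 - x pⁱ)`. -/
def qPochhammer (x p : R) (n : ℕ) : R :=
  ∏ i ∈ range n, (1 - x * p ^ i)

theorem qPochhammer_succ (x p : R) (n : ℕ) :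
    qPochhammer x p (n + 1) = qPochhammer x p n * (1 - x * p ^ n) :=
  prod_range_succ _ _

theorem qPochhammer_add (x p : R) (m n : ℕ) :
    qPochhammer x p (m + n) = qPochhammer x p m * qPochhammer (x * p ^ m) p n := by
  simp only [qPochhammer, prod_range_add, pow_add, mul_assoc]

theorem qPochhammer_succ' (x p : R) (n : ℕ) :
    qPochhammer x p (n + 1) = (1 - x) * qPochhammer (x * p) p n := by
  rw [add_comm, qPochhammer_add, pow_one, qPochhammer, prod_range_one, pow_zero, mul_one]

theorem qPochhammer_ne_zero [IsDomain R] {x p : R} (hx : ∀ k : ℕ, x * p ^ k ≠ 1) (n : ℕ) :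
    qPochhammer x p n ≠ 0 :=
  prod_ne_zero_iff.2 fun k _ => sub_ne_zero.2 (hx k).symm

end QPochhammer

section QPochhammerInf

variable {K : Type*} [NormedField K] {x p : K}

/-- The infinite `q`-Pochhammer symbol `(x; p)_∞ = ∏_{i ≥ 0} (1 - x pⁱ)`, meaningful for
`‖p‖ < 1`. -/
noncomputable def qPochhammerInf (x p : K) : K := ∏' i : ℕ, (1 - x * p ^ i)

theorem norm_pow_lt_one (hp : ‖p‖ < 1) {n : ℕ} (hn : n ≠ 0) : ‖p ^ n‖ < 1 := by
  rw [norm_pow]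
  exact pow_lt_one₀ (norm_nonneg _) hp hn

theorem mul_pow_self_ne_one (hp : ‖p‖ < 1) (n : ℕ) : p * p ^ n ≠ 1 := by
  intro h
  have hlt := norm_pow_lt_one hp n.succ_ne_zero
  rw [pow_succ', h, norm_one] at hlt
  exact lt_irrefl _ hlt

theorem summable_norm_neg_mul_pow (x : K) (hp : ‖p‖ < 1) :
    Summable fun i : ℕ => ‖-(x * p ^ i)‖ := by
  simp only [norm_neg, norm_mul, norm_pow]
  exact (summable_geometric_of_lt_one (norm_nonneg _) hp).mul_left _

variable [CompleteSpace K]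

theorem qPochhammerInf_ne_zero (hp : ‖p‖ < 1) (hx : ∀ k : ℕ, x * p ^ k ≠ 1) :
    qPochhammerInf x p ≠ 0 := by
  simp only [qPochhammerInf, sub_eq_add_neg]
  refine tprod_one_add_ne_zero_of_summable (fun k => ?_) (summable_norm_neg_mul_pow x hp)
  rw [← sub_eq_add_neg]
  exact sub_ne_zero.2 (hx k).symm

theorem tendsto_qPochhammer (x : K) (hp : ‖p‖ < 1) :
    Tendsto (qPochhammer x p) atTop (𝓝 (qPochhammerInf x p)) := by
  have h := (multipliable_one_add_of_summable
    (summable_norm_neg_mul_pow x hp)).hasProd.tendsto_prod_nat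
  simp only [← sub_eq_add_neg] at h
  exact h

theorem exists_norm_qPochhammer_mul_pow_le (hp : ‖p‖ < 1) (hx : ∀ k : ℕ, x * p ^ k ≠ 1) :
    ∃ C, ∀ m n, ‖qPochhammer (x * p ^ m) p n‖ ≤ C ∧ ‖(qPochhammer (x * p ^ m) p n)⁻¹‖ ≤ C := by
  obtain ⟨C, hC⟩ := exists_norm_div_le_of_tendsto (tendsto_qPochhammer x hp)
    (qPochhammerInf_ne_zero hp hx)
  refine ⟨C, fun m n => ?_⟩
  have hdiv : qPochhammer (x * p ^ m) p n = qPochhammer x p (m + n) / qPochhammer x p m := by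
    rw [qPochhammer_add, mul_div_cancel_left₀ _ (qPochhammer_ne_zero hx m)]
  rw [hdiv, inv_div]
  exact ⟨hC _ _, hC _ _⟩

end QPochhammerInf

section HeineCoeff

variable {K : Type*} [Field K] {p x : K}

/-- The coefficient `(p^{m+1}; p)ₙ / (x pᵐ; p)ₙ₊₁` of `zᵐ` in `heineSeries p x z n`. -/
def heineCoeff (p x : K) (n m : ℕ) : K :=
  qPochhammer (p ^ (m + 1)) p n / qPochhammer (x * p ^ m) p (n + 1)

theorem heineCoeff_zero_left (p x : K) (m : ℕ) :
    heineCoeff p x 0 m = (1 - x * p ^ m)⁻¹ := by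
  simp [heineCoeff, qPochhammer]

theorem heineCoeff_succ_left {n m : ℕ} (hx : x * p ^ (m + n + 1) ≠ 1) :
    heineCoeff p x (n + 1) m * (1 - x * p ^ (m + n + 1)) =
      heineCoeff p x n m * (1 - p ^ (m + n + 1)) := by
  have hne : 1 - x * p ^ (m + n + 1) ≠ 0 := sub_ne_zero.2 hx.symm
  rw [heineCoeff, heineCoeff, qPochhammer_succ _ _ n, qPochhammer_succ _ _ (n + 1),
    show x * p ^ m * p ^ (n + 1) = x * p ^ (m + n + 1) by ring,
    show p ^ (m + 1) * p ^ n = p ^ (m + n + 1) by ring, ← div_div, div_mul_cancel₀ _ hne,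
    mul_div_right_comm]

theorem heineCoeff_succ_right {m : ℕ} (hx : x * p ^ m ≠ 1) (n : ℕ) :
    heineCoeff p x n (m + 1) * (1 - p ^ (m + 1)) =
      heineCoeff p x (n + 1) m * (1 - x * p ^ m) := by
  have hne : 1 - x * p ^ m ≠ 0 := sub_ne_zero.2 hx.symm
  rw [heineCoeff, heineCoeff, qPochhammer_succ' (p ^ (m + 1)), qPochhammer_succ' (x * p ^ m),
    mul_assoc x, ← pow_succ, ← pow_succ, mul_comm (1 - x * p ^ m), ← div_div,
    div_mul_cancel₀ _ hne, mul_div_assoc, mul_comm]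

end HeineCoeff

section HeineSeries

variable {K : Type*} [NormedField K] {p x z : K}

/-- Heine's basic hypergeometric series `∑ₘ zᵐ (p^{m+1}; p)ₙ / (x pᵐ; p)ₙ₊₁`, which is
`(p; p)ₙ / (x; p)ₙ₊₁ · ₂φ₁(p^{n+1}, x; x p^{n+1}; p, z)`. -/
noncomputable def heineSeries (p x z : K) (n : ℕ) : K := ∑' m : ℕ, z ^ m * heineCoeff p x n m

theorem heineSeries_zero_right (p x z : K) :
    heineSeries p x z 0 = ∑' m : ℕ, z ^ m / (1 - x * p ^ m) :=
  tsum_congr fun m => by rw [heineCoeff_zero_left, div_eq_mul_inv]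

variable [CompleteSpace K]

theorem exists_norm_heineCoeff_le (hp : ‖p‖ < 1) (hx : ∀ k : ℕ, x * p ^ k ≠ 1) :
    ∃ C, ∀ n m, ‖heineCoeff p x n m‖ ≤ C := by
  obtain ⟨C, hC⟩ := exists_norm_qPochhammer_mul_pow_le hp (mul_pow_self_ne_one hp)
  obtain ⟨D, hD⟩ := exists_norm_qPochhammer_mul_pow_le hp hx
  refine ⟨C * D, fun n m => ?_⟩
  rw [heineCoeff, div_eq_mul_inv, pow_succ']
  exact norm_mul_le_of_le (hC m n).1 (hD m (n + 1)).2

theorem summable_heineSeries (hp : ‖p‖ < 1) (hx : ∀ k : ℕ, x * p ^ k ≠ 1) (hz : ‖z‖ < 1)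
    (n : ℕ) : Summable fun m : ℕ => z ^ m * heineCoeff p x n m := by
  obtain ⟨C, hC⟩ := exists_norm_heineCoeff_le hp hx
  refine .of_norm_bounded ((summable_geometric_of_lt_one (norm_nonneg z) hz).mul_right C)
    fun m => ?_
  rw [← norm_pow]
  exact norm_mul_le_of_le le_rfl (hC n m)

theorem hasSum_heineSeries (hp : ‖p‖ < 1) (hx : ∀ k : ℕ, x * p ^ k ≠ 1) (hz : ‖z‖ < 1)
    (n : ℕ) : HasSum (fun m : ℕ => z ^ m * heineCoeff p x n m) (heineSeries p x z n) :=
  (summable_heineSeries hp hx hz n).hasSum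

theorem hasSum_heineSeries_mul (hp : ‖p‖ < 1) (hx : ∀ k : ℕ, x * p ^ k ≠ 1) (hz : ‖z‖ < 1)
    (n : ℕ) :
    HasSum (fun m : ℕ => z ^ m * p ^ m * heineCoeff p x n m) (heineSeries p x (p * z) n) := by
  have hpz : ‖p * z‖ < 1 := by
    rw [norm_mul]
    exact mul_lt_one_of_nonneg_of_lt_one_left (norm_nonneg _) hp hz.le
  simpa only [mul_pow, mul_comm (p ^ _)] using hasSum_heineSeries hp hx hpz n

theorem one_sub_mul_heineSeries_zero_sub (hp : ‖p‖ < 1) (hx : ∀ k : ℕ, x * p ^ k ≠ 1)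
    (hz : ‖z‖ < 1) :
    (1 - z) * (heineSeries p x z 0 - x * heineSeries p x (p * z) 0) = 1 := by
  have hz1 : 1 - z ≠ 0 := sub_ne_zero.2 fun h => by simp [← h] at hz
  have hsum := (hasSum_heineSeries hp hx hz 0).sub
    ((hasSum_heineSeries_mul hp hx hz 0).mul_left x)
  have hgeom : HasSum (fun m : ℕ => z ^ m * heineCoeff p x 0 m -
      x * (z ^ m * p ^ m * heineCoeff p x 0 m)) (1 - z)⁻¹ := by
    refine (hasSum_geometric_of_norm_lt_one hz).congr_fun fun m => ?_
    have hne : 1 - x * p ^ m ≠ 0 := sub_ne_zero.2 (hx m).symm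
    rw [heineCoeff_zero_left]
    field_simp
  rw [hsum.unique hgeom, mul_inv_cancel₀ hz1]

theorem heineSeries_sub_heineSeries_mul (hp : ‖p‖ < 1) (hx : ∀ k : ℕ, x * p ^ k ≠ 1)
    (hz : ‖z‖ < 1) (n : ℕ) :
    heineSeries p x z n - heineSeries p x (p * z) n =
      z * (heineSeries p x z (n + 1) - x * heineSeries p x (p * z) (n + 1)) := by
  have hleft := (hasSum_heineSeries hp hx hz n).sub (hasSum_heineSeries_mul hp hx hz n)
  have hright := ((hasSum_heineSeries hp hx hz (n + 1)).sub
    ((hasSum_heineSeries_mul hp hx hz (n + 1)).mul_left x)).mul_left z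
  -- The summand on the left vanishes at `m = 0`, and shifting `m` turns it into the right one.
  refine hleft.unique ((hasSum_nat_add_iff' 1).1 ?_)
  simp only [sum_range_one, pow_zero, mul_one, sub_self, sub_zero]
  refine hright.congr_fun fun m => ?_
  linear_combination z ^ (m + 1) * heineCoeff_succ_right (hx m) n

theorem heineSeries_succ_sub (hp : ‖p‖ < 1) (hx : ∀ k : ℕ, x * p ^ k ≠ 1) (hz : ‖z‖ < 1)
    (n : ℕ) :
    heineSeries p x z (n + 1) - x * p ^ (n + 1) * heineSeries p x (p * z) (n + 1) =
      heineSeries p x z n - p ^ (n + 1) * heineSeries p x (p * z) n := by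
  have hleft := (hasSum_heineSeries hp hx hz (n + 1)).sub
    ((hasSum_heineSeries_mul hp hx hz (n + 1)).mul_left (x * p ^ (n + 1)))
  have hright := (hasSum_heineSeries hp hx hz n).sub
    ((hasSum_heineSeries_mul hp hx hz n).mul_left (p ^ (n + 1)))
  refine hleft.unique (hright.congr_fun fun m => ?_)
  linear_combination z ^ m * heineCoeff_succ_left (hx (m + n + 1))

theorem heineSeries_contiguous_mul (hp : ‖p‖ < 1) (hx : ∀ k : ℕ, x * p ^ k ≠ 1) (hz : ‖z‖ < 1)
    (n : ℕ) :
    z * (1 - p ^ (n + 1)) * x * heineSeries p x (p * z) (n + 1) =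
      (1 - z * p ^ (n + 1)) * heineSeries p x (p * z) n - (1 - z) * heineSeries p x z n := by
  linear_combination heineSeries_sub_heineSeries_mul hp hx hz n +
    z * heineSeries_succ_sub hp hx hz n

theorem heineSeries_contiguous_succ (hp : ‖p‖ < 1) (hx : ∀ k : ℕ, x * p ^ k ≠ 1) (hz : ‖z‖ < 1)
    (n : ℕ) :
    p ^ (n + 1) * (1 - z) * x * heineSeries p x (p * z) (n + 1) =
      (1 - z * p ^ (n + 1)) * heineSeries p x z (n + 1) -
        (1 - p ^ (n + 1)) * heineSeries p x z n := by
  linear_combination -p ^ (n + 1) * heineSeries_sub_heineSeries_mul hp hx hz n -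
    heineSeries_succ_sub hp hx hz n

theorem tendsto_heineCoeff_zero_right (hp : ‖p‖ < 1) (hx : ∀ k : ℕ, x * p ^ k ≠ 1) :
    Tendsto (heineCoeff p x · 0) atTop (𝓝 (qPochhammerInf p p / qPochhammerInf x p)) := by
  simp only [heineCoeff, zero_add, pow_zero, pow_one, mul_one]
  exact (tendsto_qPochhammer p hp).div
    ((tendsto_add_atTop_iff_nat 1).2 (tendsto_qPochhammer x hp)) (qPochhammerInf_ne_zero hp hx)

theorem tendsto_heineSeries {ι : Type*} {l : Filter ι} {w : ι → K} {n : ι → ℕ} (hp : ‖p‖ < 1)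
    (hx : ∀ k : ℕ, x * p ^ k ≠ 1) (hw : Tendsto w l (𝓝 0)) (hn : Tendsto n l atTop) :
    Tendsto (fun i => heineSeries p x (w i) (n i)) l
      (𝓝 (qPochhammerInf p p / qPochhammerInf x p)) := by
  obtain ⟨C, hC⟩ := exists_norm_heineCoeff_le hp hx
  have hw_half : ∀ᶠ i in l, ‖w i‖ ≤ 1 / 2 :=
    (tendsto_zero_iff_norm_tendsto_zero.1 hw).eventually_le_const (by norm_num)
  have hterm (m : ℕ) : Tendsto (fun i => w i ^ m * heineCoeff p x (n i) m) l
      (𝓝 (if m = 0 then qPochhammerInf p p / qPochhammerInf x p else 0)) := by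
    obtain rfl | hm := eq_or_ne m 0
    · simp only [pow_zero, one_mul, if_true]
      exact (tendsto_heineCoeff_zero_right hp hx).comp hn
    · have hpow : Tendsto (fun i => w i ^ m) l (𝓝 0) := by
        simpa only [zero_pow hm] using hw.pow m
      rw [if_neg hm]
      exact hpow.zero_mul_isBoundedUnder_le (isBoundedUnder_of ⟨C, fun i => hC (n i) m⟩)
  have hbound : ∀ᶠ i in l, ∀ m, ‖w i ^ m * heineCoeff p x (n i) m‖ ≤ (1 / 2) ^ m * C := by
    filter_upwards [hw_half] with i hi m
    refine norm_mul_le_of_le ?_ (hC (n i) m)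
    rw [norm_pow]
    gcongr
  simpa only [heineSeries, tsum_ite_eq] using
    tendsto_tsum_of_dominated_convergence (summable_geometric_two.mul_right C) hterm hbound

end HeineSeries

section HeineRemainder

variable {K : Type*} [NormedField K] {q x : K}

/-- The renormalized remainders `S q 0, S (q³) 0, S (q³) 1, S (q⁵) 1, …` of the continued fraction,
where `S z n = heineSeries (q ^ 2) x z n`. -/
noncomputable def heineRemainder (q x : K) (N : ℕ) : K :=
  heineSeries (q ^ 2) x (q ^ (2 * ((N + 1) / 2) + 1)) (N / 2)

theorem heineRemainder_even (q x : K) (n : ℕ) :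
    heineRemainder q x (2 * n) = heineSeries (q ^ 2) x (q ^ (2 * n + 1)) n := by
  unfold heineRemainder
  congr 2 <;> omega

theorem heineRemainder_odd (q x : K) (n : ℕ) :
    heineRemainder q x (2 * n + 1) = heineSeries (q ^ 2) x (q ^ (2 * n + 3)) n := by
  unfold heineRemainder
  congr 2 <;> omega

theorem heineRemainder_zero (q x : K) :
    heineRemainder q x 0 = ∑' n : ℕ, q ^ n / (1 - x * (q ^ 2) ^ n) := by
  rw [← heineSeries_zero_right, ← mul_zero 2, heineRemainder_even, mul_zero, zero_add, pow_one]

variable [CompleteSpace K]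

theorem heineRemainder_initial (hq : ‖q‖ < 1) (hx : ∀ k : ℕ, x * (q ^ 2) ^ k ≠ 1) :
    (1 - q) * (heineRemainder q x 0 - x * heineRemainder q x 1) = 1 := by
  have h := one_sub_mul_heineSeries_zero_sub (norm_pow_lt_one hq two_ne_zero) hx hq
  have hS₀ := heineRemainder_even q x 0
  have hS₁ := heineRemainder_odd q x 0
  simp only [mul_zero, zero_add, pow_one] at hS₀ hS₁
  rwa [← pow_succ, ← hS₀, ← hS₁] at h

theorem heineRemainder_recurrence (hq : ‖q‖ < 1) (hx : ∀ k : ℕ, x * (q ^ 2) ^ k ≠ 1) (N : ℕ) :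
    q ^ (N + 1) * (1 - q ^ (N + 2)) * x * heineRemainder q x (N + 2) =
      (1 - q ^ (2 * N + 3)) * heineRemainder q x (N + 1) -
        (1 - q ^ (N + 1)) * heineRemainder q x N := by
  have hp := norm_pow_lt_one hq two_ne_zero
  obtain ⟨n, rfl | rfl⟩ := N.even_or_odd'
  · have hz : ‖q ^ (2 * n + 1)‖ < 1 := norm_pow_lt_one hq (Nat.succ_ne_zero _)
    rw [show 2 * n + 2 = 2 * (n + 1) by ring, heineRemainder_even, heineRemainder_odd,
      heineRemainder_even]
    convert heineSeries_contiguous_mul hp hx hz n using 3 <;> ring_nf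
  · have hz : ‖q ^ (2 * n + 3)‖ < 1 := norm_pow_lt_one hq (Nat.succ_ne_zero _)
    rw [show 2 * n + 1 + 2 = 2 * (n + 1) + 1 by ring, show 2 * n + 1 + 1 = 2 * (n + 1) by ring,
      heineRemainder_odd, heineRemainder_odd, heineRemainder_even]
    convert heineSeries_contiguous_succ hp hx hz n using 3 <;> ring_nf

theorem isRemainderSeq_heineRemainder (hq : ‖q‖ < 1) (hx : ∀ k : ℕ, x * (q ^ 2) ^ k ≠ 1)
    {g : GenContFract K} (hg_zero : g.s.get? 0 = some ⟨1, 1 - q⟩)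
    (hg_succ : ∀ n, g.s.get? (n + 1) =
      some ⟨-(q ^ n * x * (1 - q ^ (n + 1)) ^ 2), 1 - q ^ (2 * (n + 1) + 1)⟩) :
    IsRemainderSeq g (fun n => 1 - q ^ (2 * n + 1)) (fun n => 1 - q * q ^ n)
      (fun n => q ^ n * (1 - q ^ (n + 1)) * x) (heineRemainder q x) where
  get?_zero := by simpa using hg_zero
  get?_succ n := by
    rw [hg_succ]
    congr 2
    ring
  initial := by
    linear_combination heineRemainder_initial hq hx
  recurrence n := by
    linear_combination heineRemainder_recurrence hq hx n

theorem tendsto_heineRemainder (hq : ‖q‖ < 1) (hx : ∀ k : ℕ, x * (q ^ 2) ^ k ≠ 1) :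
    Tendsto (heineRemainder q x) atTop
      (𝓝 (qPochhammerInf (q ^ 2) (q ^ 2) / qPochhammerInf x (q ^ 2))) := by
  have hexp : Tendsto (fun N : ℕ => 2 * ((N + 1) / 2) + 1) atTop atTop :=
    tendsto_atTop_mono (fun N => show N ≤ _ by omega) tendsto_id
  exact tendsto_heineSeries (norm_pow_lt_one hq two_ne_zero) hx
    ((tendsto_pow_atTop_nhds_zero_of_norm_lt_one hq).comp hexp)
    (Nat.tendsto_div_const_atTop two_ne_zero)

end HeineRemainder

theorem proposition4_general {K : Type*} [NormedField K] [CompleteSpace K] {q x : K}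
    (hq : ‖q‖ < 1) (hx : ∀ n : ℕ, x * q ^ (2 * n) ≠ 1) {g : GenContFract K} (hg_head : g.h = 0)
    (hg_zero : g.s.get? 0 = some ⟨1, 1 - q⟩)
    (hg_succ : ∀ n, g.s.get? (n + 1) =
      some ⟨-(q ^ n * x * (1 - q ^ (n + 1)) ^ 2), 1 - q ^ (2 * (n + 1) + 1)⟩) :
    Summable (fun n : ℕ => q ^ n / (1 - x * q ^ (2 * n))) ∧ (∀ᶠ n in atTop, g.dens n ≠ 0) ∧
      Tendsto g.convs atTop (𝓝 (∑' n : ℕ, q ^ n / (1 - x * q ^ (2 * n)))) := by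
  simp only [pow_mul] at hx ⊢
  have hp := norm_pow_lt_one hq two_ne_zero
  have hratio : Tendsto (fun n => q ^ n * (1 - q ^ (n + 1)) * x) atTop (𝓝 0) := by
    have h := tendsto_pow_atTop_nhds_zero_of_norm_lt_one hq
    simpa only [zero_mul] using
      (h.mul (((tendsto_add_atTop_iff_nat 1).2 h).const_sub 1)).mul_const x
  have hlim_ne : qPochhammerInf (q ^ 2) (q ^ 2) / qPochhammerInf x (q ^ 2) ≠ 0 :=
    div_ne_zero (qPochhammerInf_ne_zero hp (mul_pow_self_ne_one hp)) (qPochhammerInf_ne_zero hp hx)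
  have hconv := (isRemainderSeq_heineRemainder hq hx hg_zero hg_succ).tendsto_convs
    (tendsto_qPochhammer q hq) (qPochhammerInf_ne_zero hq (mul_pow_self_ne_one hq)) hratio
    (tendsto_heineRemainder hq hx) hlim_ne
  rw [hg_head, zero_add, heineRemainder_zero] at hconv
  refine ⟨(summable_heineSeries hp hx hq 0).congr fun n => ?_, hconv⟩
  rw [heineCoeff_zero_left, div_eq_mul_inv]

theorem proposition4 (q a : ℂ) (hq : ‖q‖ < 1) (ha : ∀ n : ℕ, a ^ 2 * q ^ (2 * n) ≠ 1) :
    Summable (fun n : ℕ => q ^ n / (1 - a ^ 2 * q ^ (2 * n))) ∧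
      ContFractConvergesTo (infiniteContFract (ramanujanNum a q) (ramanujanDen q))
        (∑' n : ℕ, q ^ n / (1 - a ^ 2 * q ^ (2 * n))) :=
  proposition4_general hq ha rfl
    (congrArg some (congrArg (GenContFract.Pair.mk 1) (by simp [ramanujanDen]))) fun _ => rfl
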